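/- Let $n\ge 1$ and let $G=\langle r_0,\dots,r_{n-1}\rangle\subset GL(V)$ be the linear Coxeter group, in its standard representation on $V=\mathbb{R}^n$, of a string Coxeter diagram $[p_1,\dots,p_{n-1}]$ ($2\le p_j\le\infty$): with simple roots $\alpha_0,\dots,\alpha_{n-1}$ a basis of $V$ and the form $\alpha_i\cdot\alpha_j=-\cos(\pi/p_{ij})$, where $p_{ij}$ is the period of $r_ir_j$ in the Coxeter group ($p_{j-1,j}=p_j$, and $p_{ij}=2$ for $|i-j|\ge 2$; the value is $-1$ if $p_{ij}=\infty$), put $r_i(x)=x-2(\alpha_i\cdot x)\alpha_i$. Assume that $G$ is crystallographic and fix a basic system for it, that is, nonzero multiples $b_j$ of the $\alpha_j$ and integers $m_{ij}$ such that $r_i(b_j)=b_j+m_{ij}b_i$ for all $i,j$. In the basis $(b_j)$ the group $G$ becomes a subgroup of $GL_n(\mathbb{Z})$; for a subgroup $K\le G$ and $s\ge 2$ let $K^s\le GL_n(\mathbb{Z}/s)$ be its image under reduction modulo $s$. For $J\subseteq\{0,\dots,n-1\}$ let $G_J=\langle r_j : j\notin J\rangle$ and $V_J=\operatorname{span}_{\mathbb{R}}(b_j: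 j\notin J)$, and write $G_k=G_{\{k\}}$, $G_{k,l}=G_{\{k,l\}}$. A group generated by $\rho_0,\dots,\rho_{n-1}$ is a string C-group (with respect to these generators) if every $\rho_i$ has order exactly $2$, $(\rho_i\rho_j)^2=1$ whenever $|i-j|\ge 2$, and $\langle\rho_i : i\in I\rangle\cap\langle\rho_i : i\in J\rangle=\langle\rho_i : i\in I\cap J\rangle$ for all $I,J\subseteq\{0,\dots,n-1\}$. For $G^s$ the generators are the images of the $r_i$. $G_J$ is of spherical type if it is finite. It is of Euclidean type if the diagram on the nodes outside $J$ is connected and the form restricted to $V_J$ is positive semidefinite but not positive definite; its translation group $T$ then consists of those $g\in G_J$ with $g(x)-x\in\operatorname{rad}(V_J)$ for all $x\in V_J$, where $\operatorname{rad}(V_J)=\{x\in V_J: x\cdot y=0 \text{ for all } y\in V_J\}$. Theorem. Let $s,d\ge 2$ be integers with $s\mid d$, and suppose that $G^s$ is a string C-group. Suppose also that either (a) $G_{n-1}$ is of spherical type and reduction modulo $s$ is injective on $G_{n-1}$ (so $G_{n-1}\simeq G_{n-1}^s$); or (b) $G_{n-1}$ is of Euclidean type, it is the internal semidirect product $G_{n-1}=T\rtimes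 G_{0,n-1}$ of its translation group $T$ and the subgroup $G_{0,n-1}$, reduction modulo $s$ is injective on $G_{0,n-1}$ (so $G_{0,n-1}\simeq G_{0,n-1}^s$), and $T^d\cap\langle r_1,\dots,r_{n-1}\rangle^d=\{e\}$. Then $G^d$ is a string C-group. The dual statement holds as well: if $G^s$ is a string C-group and either (a$'$) $G_0$ is of spherical type and reduction modulo $s$ is injective on $G_0$, or (b$'$) $G_0$ is of Euclidean type with translation group $T$, $G_0=T\rtimes G_{0,n-1}$, reduction modulo $s$ is injective on $G_{0,n-1}$, and $T^d\cap\langle r_0,\dots,r_{n-2}\rangle^d=\{e\}$, then $G^d$ is a string C-group. -/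

import Mathlib

noncomputable section

/-! ### String C-groups -/

/-- The subgroup `Γ`, with the specified generators `ρ 0, …, ρ (n-1)`, is a string C-group:
it is generated by these elements, they are involutions, those with non-adjacent indices commute,
and the standard subgroups satisfy the intersection condition. -/
structure IsStringCGroup {A : Type*} [Group A] {n : ℕ} (Γ : Subgroup A) (ρ : Fin n → A) :
    Prop where
  generates : Subgroup.closure (Set.range ρ) = Γ
  involution : ∀ i, ρ i ≠ 1 ∧ ρ i ^ 2 = 1
  string : ∀ i j : Fin n, (i : ℕ) + 2 ≤ (j : ℕ) → (ρ i * ρ j) ^ 2 = 1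
  intersection : ∀ I J : Set (Fin n),
    Subgroup.closure (ρ '' I) ⊓ Subgroup.closure (ρ '' J) = Subgroup.closure (ρ '' (I ∩ J))

/-- `E` is the internal semidirect product `T ⋊ H` of its subgroups `T` (normal) and `H`. -/
structure IsInternalSemidirect {A : Type*} [Group A] (E T H : Subgroup A) : Prop where
  left_le : T ≤ E
  right_le : H ≤ E
  normal : (T.subgroupOf E).Normal
  disjoint : T ⊓ H = ⊥
  sup : T ⊔ H = E

/-! ### Linear Coxeter groups -/

/-- Reduction modulo `s`, as a homomorphism `GL_n(ℤ) → GL_n(ℤ/s)`. For a subgroup `K` of `G`, its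
modular image `K^s` is `K.map (modReduction s)`. -/
def modReduction {n : ℕ} (s : ℕ) : GL (Fin n) ℤ →* GL (Fin n) (ZMod s) :=
  Matrix.GeneralLinearGroup.map (Int.castRingHom (ZMod s))

namespace CoxeterMatrix

variable {n : ℕ}

/-- The Coxeter diagram is a string (possibly disconnected): `[p₁, …, pₙ₋₁]` with
`pⱼ = M (j-1) j`; an entry `0` stands for `∞`. -/
def IsString (M : CoxeterMatrix (Fin n)) : Prop :=
  ∀ i j : Fin n, (i : ℕ) + 2 ≤ (j : ℕ) → M i j = 2

/-- The Coxeter diagram as a graph: distinct nodes are joined unless `M i j = 2`. -/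
def diagram (M : CoxeterMatrix (Fin n)) : SimpleGraph (Fin n) :=
  SimpleGraph.fromRel fun i j => M i j ≠ 2

/-- The invariant symmetric bilinear form of the standard representation on `V = ℝⁿ`, with
`αᵢ · αⱼ = -cos (π / M i j)`. For `M i j = 0` (that is `∞`), Lean's `π / 0 = 0` gives the usual
value `-1`. -/
def stdForm (M : CoxeterMatrix (Fin n)) : LinearMap.BilinForm ℝ (Fin n → ℝ) :=
  Matrix.toBilin' (Matrix.of fun i j => -Real.cos (Real.pi / (M i j : ℝ)))

/-- The unit simple root `αᵢ`. -/
def simpleRoot (_M : CoxeterMatrix (Fin n)) (i : Fin n) : Fin n → ℝ := Pi.single i 1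

/-- The reflection `rᵢ(x) = x - 2 (αᵢ · x) αᵢ` of the standard representation. -/
def stdReflection (M : CoxeterMatrix (Fin n)) (i : Fin n) : (Fin n → ℝ) →ₗ[ℝ] (Fin n → ℝ) :=
  LinearMap.id - ((2 : ℝ) • M.stdForm (M.simpleRoot i)).smulRight (M.simpleRoot i)

/-- The subspace `V_J` of `V` spanned by the roots with index outside `J`. -/
def subspaceOmit (M : CoxeterMatrix (Fin n)) (J : Set (Fin n)) : Submodule ℝ (Fin n → ℝ) :=
  Submodule.span ℝ (M.simpleRoot '' Jᶜ)

/-- The radical of the form restricted to `V_J`. -/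
def radicalOmit (M : CoxeterMatrix (Fin n)) (J : Set (Fin n)) : Submodule ℝ (Fin n → ℝ) :=
  M.subspaceOmit J ⊓ M.stdForm.orthogonal (M.subspaceOmit J)

/-- The standard subgroup `G_J` on the nodes outside `J` is of Euclidean (affine) type: its diagram
is connected and the form on `V_J` is positive semidefinite but not positive definite. -/
structure IsEuclideanOmit (M : CoxeterMatrix (Fin n)) (J : Set (Fin n)) : Prop where
  connected : (M.diagram.induce Jᶜ).Connected
  semidefinite : ∀ x ∈ M.subspaceOmit J, 0 ≤ M.stdForm x x
  degenerate : ∃ x ∈ M.subspaceOmit J, x ≠ 0 ∧ M.stdForm x x = 0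

theorem stdForm_simpleRoot_self (M : CoxeterMatrix (Fin n)) (i : Fin n) :
    M.stdForm (M.simpleRoot i) (M.simpleRoot i) = 1 := by
  simp [stdForm, simpleRoot, Matrix.toBilin'_single]

/-- A basic system for the linear Coxeter group of `M`: nonzero multiples `bⱼ` of the simple roots
such that all reflections have integral matrices in the basis `b`; equivalently, the group leaves
the lattice `∑ ℤ bⱼ` invariant. The integers `m i j` are the Cartan integers. -/
structure BasicSystem (M : CoxeterMatrix (Fin n)) where
  scale : Fin n → ℝ
  scale_ne_zero : ∀ i, scale i ≠ 0
  m : Fin n → Fin n → ℤ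
  reflection_root : ∀ i j, M.stdReflection i (scale j • M.simpleRoot j) =
    scale j • M.simpleRoot j + (m i j : ℝ) • (scale i • M.simpleRoot i)

namespace BasicSystem

variable {M : CoxeterMatrix (Fin n)} (β : M.BasicSystem)

/-- The basis `b` of `V`, with `bⱼ = scale j • αⱼ`. -/
def basis : Module.Basis (Fin n) ℝ (Fin n → ℝ) :=
  (Pi.basisFun ℝ (Fin n)).isUnitSMul (w := β.scale) fun i => (β.scale_ne_zero i).isUnit

theorem basis_apply (i : Fin n) : β.basis i = β.scale i • M.simpleRoot i := by
  rw [basis, Module.Basis.isUnitSMul_apply, Pi.basisFun_apply, simpleRoot]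

theorem m_self (i : Fin n) : β.m i i = -2 := by
  have h := congrFun (β.reflection_root i i) i
  have h1 := M.stdForm_simpleRoot_self i
  have h2 := β.scale_ne_zero i
  simp only [stdReflection, LinearMap.sub_apply, LinearMap.id_apply, LinearMap.smulRight_apply,
    LinearMap.smul_apply, map_smul, h1] at h
  simp [simpleRoot] at h
  have h3 : ((β.m i i : ℤ) : ℝ) = -2 := by
    apply mul_right_cancel₀ h2
    linarith
  exact_mod_cast h3

/-- The integral matrix of `rᵢ` in the basis `b`, from `rᵢ(bⱼ) = bⱼ + m i j • bᵢ`. -/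
def genMatrix (i : Fin n) : Matrix (Fin n) (Fin n) ℤ :=
  1 + Matrix.of fun k j => if k = i then β.m i j else 0

theorem genMatrix_mul_self (i : Fin n) : β.genMatrix i * β.genMatrix i = 1 := by
  have h : (Matrix.of fun k j => if k = i then β.m i j else 0 : Matrix (Fin n) (Fin n) ℤ) *
      (Matrix.of fun k j => if k = i then β.m i j else 0) =
      (-2 : ℤ) • (Matrix.of fun k j => if k = i then β.m i j else 0) := by
    ext k j
    by_cases hk : k = i <;> simp [Matrix.mul_apply, hk, β.m_self]
  rw [genMatrix, mul_add, add_mul, add_mul, h]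
  simp only [mul_one, one_mul]
  module

/-- The generator `rᵢ`, written as an element of `GL_n(ℤ)` in the basis `b`. -/
def gen (i : Fin n) : GL (Fin n) ℤ :=
  ⟨β.genMatrix i, β.genMatrix i, β.genMatrix_mul_self i, β.genMatrix_mul_self i⟩

/-- The linear map of `V` whose matrix in the basis `b` is `g`. -/
def act : GL (Fin n) ℤ →* Module.End ℝ (Fin n → ℝ) :=
  ((Matrix.toLinAlgEquiv β.basis : Matrix (Fin n) (Fin n) ℝ →* Module.End ℝ (Fin n → ℝ)).comp
    ((Int.castRingHom ℝ).mapMatrix.toMonoidHom :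
      Matrix (Fin n) (Fin n) ℤ →* Matrix (Fin n) (Fin n) ℝ)).comp
    (Units.coeHom _)

/-- The integral matrix `gen i` represents the standard reflection `rᵢ`. -/
theorem act_gen (i : Fin n) : β.act (β.gen i) = M.stdReflection i := by
  refine β.basis.ext fun j => ?_
  rw [β.basis_apply j, β.reflection_root i j, ← β.basis_apply, ← β.basis_apply]
  have : β.act (β.gen i) (β.basis j) =
      Matrix.toLin β.basis β.basis ((β.genMatrix i).map (Int.cast : ℤ → ℝ)) (β.basis j) := rfl
  rw [this, Matrix.toLin_self]
  have h : ∀ k, ((β.genMatrix i).map (Int.cast : ℤ → ℝ)) k j • β.basis k =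
      (if k = j then β.basis k else 0) + (if k = i then (β.m i j : ℝ) • β.basis k else 0) := by
    intro k
    by_cases h1 : k = j <;> by_cases h2 : k = i <;>
      simp [genMatrix, Matrix.one_apply, h1, h2, add_smul]
  simp only [h, Finset.sum_add_distrib, Finset.sum_ite_eq', Finset.mem_univ, if_true]

/-- The standard subgroup `G_J = ⟨rⱼ | j ∉ J⟩` of the linear Coxeter group `G`, written as
integral matrices in the basis `b`. Thus `G = G_∅`. -/
def standardOmit (J : Set (Fin n)) : Subgroup (GL (Fin n) ℤ) :=
  Subgroup.closure (β.gen '' Jᶜ)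

/-- The linear Coxeter group `G = ⟨r₀, …, rₙ₋₁⟩`. -/
def group : Subgroup (GL (Fin n) ℤ) := Subgroup.closure (Set.range β.gen)

/-- The subgroup `T` of translations in `G_J`: the elements that act trivially on
`V_J / rad V_J`. When `G_J` is of Euclidean type, `rad V_J = ℝ c`, so these are the transvections
`t(x) = x - τ(x) c` of `V_J`, that is, the elements inducing translations on the Euclidean space
`{μ ∈ V_J^* | μ(c) = 1}`. -/
def translations (J : Set (Fin n)) : Subgroup (GL (Fin n) ℤ) where
  carrier := {g | g ∈ β.standardOmit J ∧
    ∀ x ∈ M.subspaceOmit J, β.act g x - x ∈ M.radicalOmit J}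
  one_mem' := ⟨one_mem _, fun x _ => by simp⟩
  mul_mem' := by
    rintro g h ⟨hg, hg'⟩ ⟨hh, hh'⟩
    refine ⟨mul_mem hg hh, fun x hx => ?_⟩
    have h1 := hh' x hx
    have h2 : β.act h x ∈ M.subspaceOmit J := by
      have := add_mem h1.1 hx
      simpa using this
    have h3 := add_mem (hg' _ h2) h1
    simpa [map_mul] using h3
  inv_mem' := by
    rintro g ⟨hg, hg'⟩
    refine ⟨inv_mem hg, fun x hx => ?_⟩
    have hinv : ∀ y, β.act g⁻¹ (β.act g y) = y := fun y => by
      rw [← Module.End.mul_apply, ← map_mul]; simp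
    have hmaps : ∀ y ∈ M.subspaceOmit J, β.act g y ∈ M.subspaceOmit J := fun y hy => by
      have := add_mem (hg' y hy).1 hy
      simpa using this
    have hinj : Function.Injective ((β.act g).restrict hmaps) := fun a b hab => by
      have h1 : β.act g a = β.act g b := congrArg Subtype.val hab
      have h2 := congrArg (β.act g⁻¹) h1
      rw [hinv, hinv] at h2
      exact Subtype.ext h2
    obtain ⟨y, hy⟩ := LinearMap.injective_iff_surjective.1 hinj ⟨x, hx⟩
    have hy' : β.act g y = x := congrArg Subtype.val hy
    have h4 := neg_mem (hg' y y.2)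
    rw [neg_sub, hy'] at h4
    rw [← hy', hinv, hy']
    exact h4

/-! ### The hypotheses on modular reductions -/

/-- `G^s`, with the images of the `rᵢ` as generators, is a string C-group. -/
def IsStringCGroupMod (s : ℕ) : Prop :=
  IsStringCGroup (β.group.map (modReduction s)) fun i => modReduction s (β.gen i)

/-- Case (a) for the node `k`: `G_k` is of spherical type (finite) and reduction modulo `s` is
faithful on it. -/
structure SphericalCondition (s : ℕ) (k : Fin n) : Prop where
  spherical : Finite (β.standardOmit {k})
  faithful : Set.InjOn (modReduction s) (β.standardOmit {k} : Set (GL (Fin n) ℤ))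

/-- Case (b) for the node `k`, with `l` the other end node: `G_k = T ⋊ G_{l,k}` is of Euclidean
type, with `T` its subgroup of translations, reduction modulo `s` is faithful on the point group
`G_{l,k}`, and `T^d ∩ G_l^d = {e}`. -/
structure EuclideanCondition (s d : ℕ) (k l : Fin n) : Prop where
  euclidean : M.IsEuclideanOmit {k}
  semidirect : IsInternalSemidirect (β.standardOmit {k}) (β.translations {k})
    (β.standardOmit {l, k})
  faithful : Set.InjOn (modReduction s) (β.standardOmit {l, k} : Set (GL (Fin n) ℤ))
  inter : (β.translations {k}).map (modReduction d) ⊓ (β.standardOmit {l}).map (modReduction d) = ⊥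

end BasicSystem

end CoxeterMatrix

end

/-! ### Standard subgroups and the intersection property -/

section Intersection

open Set

variable {A B : Type*} [Group A] [Group B] {n : ℕ}

/-! The intersection property descends from `G^s` to `G^d` along the map `G^d → G^s`. If `g` lies in
the standard subgroups of `G^d` on `I` and `J`, its image comes from some `h` in the standard
subgroup on `I ∩ J`; when the map is injective on a subgroup containing both, `g = h`. Commutation
along the string allows `J` to omit an end node, so injectivity on one end subgroup suffices. That
is the spherical case: reduction modulo `s` factors through reduction modulo `d`, so faithfulness on
`G_{n-1}` makes `G^d → G^s` injective on its image.

In the Euclidean case only the point group `G_{0,n-1}` is known to embed. Each end subgroup becomes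
the point group after losing its other end generator, so the same criterion gives the intersection
property inside both. They glue if they meet modulo `d` in the point group: an element of `G_{n-1}`
is `t * p` with `t` a translation and `p` in the point group, and if its reduction lies in `G_0^d`,
so does that of `t`, which is therefore trivial. -/

/-- The subgroup generated by the `ρ i` with `i ∈ I`. -/
def standardSubgroup (ρ : Fin n → A) (I : Set (Fin n)) : Subgroup A :=
  Subgroup.closure (ρ '' I)

/-- The intersection property for those standard subgroups whose index sets lie in `S`. -/
def IntersectionPropertyOn (ρ : Fin n → A) (S : Set (Fin n)) : Prop :=
  ∀ I J : Set (Fin n), I ⊆ S → J ⊆ S →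
    standardSubgroup ρ I ⊓ standardSubgroup ρ J ≤ standardSubgroup ρ (I ∩ J)

/-- Generators with non-adjacent indices commute. -/
def StringCommute (ρ : Fin n → A) : Prop :=
  ∀ i j : Fin n, (i : ℕ) + 2 ≤ (j : ℕ) → Commute (ρ i) (ρ j)

theorem standardSubgroup_mono (ρ : Fin n → A) {I J : Set (Fin n)} (h : I ⊆ J) :
    standardSubgroup ρ I ≤ standardSubgroup ρ J :=
  Subgroup.closure_mono (image_mono h)

theorem map_standardSubgroup (φ : A →* B) (ρ : Fin n → A) (I : Set (Fin n)) :
    (standardSubgroup ρ I).map φ = standardSubgroup (φ ∘ ρ) I := by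
  rw [standardSubgroup, standardSubgroup, MonoidHom.map_closure, image_comp]

theorem standardSubgroup_comp_rev (ρ : Fin n → A) (I : Set (Fin n)) :
    standardSubgroup (ρ ∘ Fin.rev) I = standardSubgroup ρ (Fin.rev ⁻¹' I) := by
  rw [standardSubgroup, standardSubgroup, image_comp, Fin.rev_involutive.image_eq_preimage_symm]

theorem StringCommute.comp_rev {ρ : Fin n → A} (h : StringCommute ρ) :
    StringCommute (ρ ∘ Fin.rev) := fun i j hij =>
  (h j.rev i.rev (by simp only [Fin.val_rev]; omega)).symm

theorem IntersectionPropertyOn.of_comp_rev {ρ : Fin n → A} {S : Set (Fin n)}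
    (h : IntersectionPropertyOn (ρ ∘ Fin.rev) (Fin.rev ⁻¹' S)) : IntersectionPropertyOn ρ S := by
  intro I J hI hJ
  have := h (Fin.rev ⁻¹' I) (Fin.rev ⁻¹' J) (preimage_mono hI) (preimage_mono hJ)
  simpa only [standardSubgroup_comp_rev, ← preimage_inter, ← preimage_comp,
    Fin.rev_involutive.comp_self, preimage_id] using this

theorem IntersectionPropertyOn.comp_rev {ρ : Fin n → A} {S : Set (Fin n)}
    (h : IntersectionPropertyOn ρ S) : IntersectionPropertyOn (ρ ∘ Fin.rev) (Fin.rev ⁻¹' S) := by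
  refine .of_comp_rev ?_
  simpa only [Function.comp_assoc, Fin.rev_involutive.comp_self, ← preimage_comp, preimage_id,
    Function.comp_id] using h

theorem exists_eq_mul_of_mem_sup {T H E : Subgroup A} (hE : E = T ⊔ H)
    (hT : H ≤ Subgroup.normalizer (T : Set A)) {g : A} (hg : g ∈ E) :
    ∃ t ∈ T, ∃ h ∈ H, g = t * h := by
  rw [hE, ← SetLike.mem_coe, Subgroup.coe_mul_of_right_le_normalizer_left T H hT] at hg
  obtain ⟨t, ht, h, hh, rfl⟩ := hg
  exact ⟨t, ht, h, hh, rfl⟩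

/-- If `k ∉ I` but all indices above `k` are in `I`, the standard subgroup on `I` is the product
of the commuting standard subgroups on the indices below and above `k`. -/
theorem StringCommute.exists_eq_mul {ρ : Fin n → A} (hρ : StringCommute ρ) {I : Set (Fin n)}
    {k : Fin n} (hk : k ∉ I) (hI : Ioi k ⊆ I) {g : A} (hg : g ∈ standardSubgroup ρ I) :
    ∃ a ∈ standardSubgroup ρ (I ∩ Iio k), ∃ u ∈ standardSubgroup ρ (Ioi k), g = a * u := by
  have hunion : I = (I ∩ Iio k) ∪ Ioi k := by
    ext i
    rcases lt_trichotomy i k with h | rfl | h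
    · simp [h, h.le]
    · simp [hk]
    · simp [h, hI h]
  refine exists_eq_mul_of_mem_sup (E := standardSubgroup ρ I) ?_ ?_ hg
  · conv_lhs => rw [hunion, standardSubgroup, image_union, Subgroup.closure_union]
    rfl
  -- Indices on opposite sides of the missing `k` differ by at least two, so the two blocks
  -- centralize each other.
  · refine le_trans ?_ (Subgroup.centralizer_le_normalizer _)
    refine (Subgroup.closure_le _).2 ?_
    rintro _ ⟨j, hj, rfl⟩
    refine Subgroup.mem_centralizer_iff.2 fun x hx => ?_
    refine Subgroup.closure_induction (p := fun x _ => Commute x (ρ j)) ?_ (Commute.one_left _)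
      (fun _ _ _ _ h₁ h₂ => h₁.mul_left h₂) (fun _ _ h => h.inv_left) hx
    rintro _ ⟨i, hi, rfl⟩
    have h₁ : i < k := hi.2
    have h₂ : k < j := hj
    exact hρ i j (by omega)

/-- The largest missing index is the node at which the string is cut. -/
theorem exists_notMem_Ioi_subset {I : Set (Fin n)} (hI : I ≠ univ) : ∃ k ∉ I, Ioi k ⊆ I := by
  obtain ⟨k, hk, hmax⟩ := (toFinite Iᶜ).exists_maximal (nonempty_compl.2 hI)
  refine ⟨k, hk, fun j hj => ?_⟩
  by_contra h
  exact absurd (hmax h hj.le) (not_le.2 hj)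

/-- It suffices to check the intersection property when one of the index sets omits the last
index. -/
theorem StringCommute.intersectionPropertyOn {ρ : Fin (n + 1) → A} (hρ : StringCommute ρ)
    {S : Set (Fin (n + 1))}
    (h : ∀ I J : Set (Fin (n + 1)), I ⊆ S → J ⊆ S → Fin.last n ∉ J →
      standardSubgroup ρ I ⊓ standardSubgroup ρ J ≤ standardSubgroup ρ (I ∩ J)) :
    IntersectionPropertyOn ρ S := by
  intro I J hI hJ
  rcases eq_or_ne I univ with rfl | hIu
  · simp
  rcases eq_or_ne J univ with rfl | hJu
  · simp
  obtain ⟨k, hk, hkI⟩ := exists_notMem_Ioi_subset hIu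
  obtain ⟨l, hl, hlJ⟩ := exists_notMem_Ioi_subset hJu
  wlog hkl : k ≤ l generalizing I J k l
  · rw [inf_comm, inter_comm]
    exact this J I hJ hI hJu hIu l hl hlJ k hk hkI (le_of_not_ge hkl)
  rintro g ⟨hgI, hgJ⟩
  obtain ⟨b, hb, v, hv, rfl⟩ := hρ.exists_eq_mul hl hlJ hgJ
  have hlI : Ioi l ⊆ I := (Ioi_subset_Ioi hkl).trans hkI
  -- As `k ≤ l`, the tail `v` also lies in the subgroup on `I`; stripping it leaves `b`, whose index
  -- set omits the last node.
  have hbI : b ∈ standardSubgroup ρ I :=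
    (Subgroup.mul_mem_cancel_right _ (standardSubgroup_mono ρ hlI hv)).1 hgI
  refine mul_mem (standardSubgroup_mono ρ ?_ (h I (J ∩ Iio l) hI (inter_subset_left.trans hJ)
    (fun hmem => not_lt.2 (Fin.le_last l) hmem.2) ⟨hbI, hb⟩))
    (standardSubgroup_mono ρ (subset_inter hlI hlJ) hv)
  exact inter_subset_inter_right _ inter_subset_left

/-- Quotient criterion: the intersection property lifts along a homomorphism that is injective on
the standard subgroup omitting the last generator. -/
theorem StringCommute.intersectionPropertyOn_of_injOn {ρ : Fin (n + 1) → A}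
    (hρ : StringCommute ρ) {S : Set (Fin (n + 1))} (φ : A →* B)
    (hφ : IntersectionPropertyOn (φ ∘ ρ) S)
    (hinj : InjOn φ (standardSubgroup ρ (S ∩ {Fin.last n}ᶜ) : Set A)) :
    IntersectionPropertyOn ρ S := by
  refine hρ.intersectionPropertyOn fun I J hI hJ hlast g ⟨hgI, hgJ⟩ => ?_
  have hJ' : J ⊆ S ∩ {Fin.last n}ᶜ := subset_inter hJ (by simpa using hlast)
  have hmem : φ g ∈ standardSubgroup (φ ∘ ρ) (I ∩ J) := by
    refine hφ I J hI hJ ⟨?_, ?_⟩ <;> rw [← map_standardSubgroup]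
    · exact Subgroup.mem_map_of_mem φ hgI
    · exact Subgroup.mem_map_of_mem φ hgJ
  rw [← map_standardSubgroup] at hmem
  obtain ⟨h, hh, hhg⟩ := hmem
  have : h = g := hinj (standardSubgroup_mono ρ (inter_subset_right.trans hJ') hh)
    (standardSubgroup_mono ρ hJ' hgJ) hhg
  exact this ▸ hh

/-- The quotient criterion with the roles of the first and last generators exchanged. -/
theorem StringCommute.intersectionPropertyOn_of_injOn_zero {ρ : Fin (n + 1) → A}
    (hρ : StringCommute ρ) {S : Set (Fin (n + 1))} (φ : A →* B)
    (hφ : IntersectionPropertyOn (φ ∘ ρ) S)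
    (hinj : InjOn φ (standardSubgroup ρ (S ∩ {0}ᶜ) : Set A)) :
    IntersectionPropertyOn ρ S := by
  refine .of_comp_rev (hρ.comp_rev.intersectionPropertyOn_of_injOn φ hφ.comp_rev ?_)
  rw [standardSubgroup_comp_rev]
  convert hinj using 4
  ext i
  simp [Fin.rev_eq_iff]

/-- If both maximal end subgroups have the intersection property and they meet in the standard
subgroup omitting both ends, then the whole group has the intersection property. -/
theorem StringCommute.intersectionPropertyOn_univ {ρ : Fin (n + 1) → A} (hρ : StringCommute ρ)
    (h₀ : IntersectionPropertyOn ρ {0}ᶜ) (h₁ : IntersectionPropertyOn ρ {Fin.last n}ᶜ)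
    (h : standardSubgroup ρ {0}ᶜ ⊓ standardSubgroup ρ {Fin.last n}ᶜ ≤
      standardSubgroup ρ {0, Fin.last n}ᶜ) :
    IntersectionPropertyOn ρ univ := by
  refine hρ.intersectionPropertyOn fun I J _ _ hlast g ⟨hgI, hgJ⟩ => ?_
  have hJ : J ⊆ {Fin.last n}ᶜ := by simpa using hlast
  rcases eq_or_ne I univ with rfl | hIu
  · simpa using hgJ
  obtain ⟨k, hk, hkI⟩ := exists_notMem_Ioi_subset hIu
  have hA : I ∩ Iio k ⊆ {Fin.last n}ᶜ := fun i hi => ((mem_Iio.1 hi.2).trans_le k.le_last).ne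
  have hU : Ioi k ⊆ {0}ᶜ := fun i hi => ((Fin.zero_le k).trans_lt hi).ne'
  obtain ⟨a, ha, u, hu, rfl⟩ := hρ.exists_eq_mul hk hkI hgI
  -- Both `a * u` and `a` avoid the last generator, hence so does `u`. It then lies in both end
  -- subgroups, and `h`, `h₀` remove the last index from its tail, so `a * u` falls under `h₁`.
  have hu₁ : u ∈ standardSubgroup ρ {Fin.last n}ᶜ :=
    (Subgroup.mul_mem_cancel_left _ (standardSubgroup_mono ρ hA ha)).1
      (standardSubgroup_mono ρ hJ hgJ)
  have hu₂ := h₀ (Ioi k) {0, Fin.last n}ᶜ hU (by simp)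
    ⟨hu, h ⟨standardSubgroup_mono ρ hU hu, hu₁⟩⟩
  have hau : a * u ∈ standardSubgroup ρ (I ∩ {Fin.last n}ᶜ) := by
    refine mul_mem (standardSubgroup_mono ρ (subset_inter inter_subset_left hA) ha)
      (standardSubgroup_mono ρ (inter_subset_inter hkI ?_) hu₂)
    simp
  exact standardSubgroup_mono ρ (inter_subset_inter_left _ inter_subset_left)
    (h₁ _ J inter_subset_right hJ ⟨hau, hgJ⟩)

end Intersection

/-! ### Crystallographic generators and their modular reductions -/

namespace CoxeterMatrix.BasicSystem

open Set

variable {n : ℕ} {M : CoxeterMatrix (Fin n)} (β : M.BasicSystem)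

theorem m_eq_zero {i j : Fin n} (h : M i j = 2) : β.m i j = 0 := by
  have hform : M.stdForm (M.simpleRoot i) (M.simpleRoot j) = 0 := by
    simp [stdForm, simpleRoot, Matrix.toBilin'_single, h]
  have key := β.reflection_root i j
  simp only [stdReflection, LinearMap.sub_apply, LinearMap.id_apply, LinearMap.smulRight_apply,
    LinearMap.smul_apply, map_smul, hform, smul_zero, zero_smul, sub_zero] at key
  have := congrFun (left_eq_add.1 key) i
  simpa [simpleRoot, β.scale_ne_zero i] using this

theorem gen_commute {i j : Fin n} (h : M i j = 2) : Commute (β.gen i) (β.gen j) := by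
  have hij := β.m_eq_zero h
  have hji := β.m_eq_zero (M.symmetric j i ▸ h : M j i = 2)
  -- The product of the rank-one parts of `gen a` and `gen b` carries the factor `m a b`.
  have hzero : ∀ a b : Fin n, β.m a b = 0 →
      (Matrix.of fun k l => if k = a then β.m a l else 0 : Matrix (Fin n) (Fin n) ℤ) *
        (Matrix.of fun k l => if k = b then β.m b l else 0) = 0 := by
    intro a b hab
    ext k l
    simp [Matrix.mul_apply, hab]
  refine Units.ext ?_
  change β.genMatrix i * β.genMatrix j = β.genMatrix j * β.genMatrix i
  simp only [genMatrix, mul_add, add_mul, one_mul, mul_one, hzero i j hij, hzero j i hji]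
  abel

theorem gen_sq (i : Fin n) : β.gen i ^ 2 = 1 := by
  rw [sq]
  exact Units.ext (β.genMatrix_mul_self i)

theorem stringCommute_gen (hM : M.IsString) {A : Type*} [Group A] (φ : GL (Fin n) ℤ →* A) :
    StringCommute (φ ∘ β.gen) := fun i j hij =>
  (β.gen_commute (hM i j hij)).map φ

theorem standardOmit_eq (J : Set (Fin n)) : β.standardOmit J = standardSubgroup β.gen Jᶜ := rfl

/-- Reduction from `GL_n(ℤ/d)` to `GL_n(ℤ/s)` for `s ∣ d`. -/
def modCast {s d : ℕ} (h : s ∣ d) : GL (Fin n) (ZMod d) →* GL (Fin n) (ZMod s) :=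
  Matrix.GeneralLinearGroup.map (ZMod.castHom h (ZMod s))

theorem modCast_comp_modReduction {s d : ℕ} (h : s ∣ d) :
    (modCast h).comp (modReduction d) = (modReduction s : GL (Fin n) ℤ →* _) := by
  ext g i j
  simp [modCast, modReduction]

/-- Reducing modulo `d` and then `s` is reducing modulo `s`; an injective composite forces its
second map to be injective on the image of the first. -/
theorem injOn_modCast {s d : ℕ} (h : s ∣ d) {I : Set (Fin n)}
    (hinj : InjOn (modReduction s) (standardSubgroup β.gen I : Set (GL (Fin n) ℤ))) :
    InjOn (modCast h) (standardSubgroup (modReduction d ∘ β.gen) I : Set (GL (Fin n) (ZMod d))) := by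
  rw [← map_standardSubgroup, Subgroup.coe_map]
  refine InjOn.image_of_comp ?_
  rwa [← MonoidHom.coe_comp, modCast_comp_modReduction]

/-- `G^d` is a string C-group as soon as it has the intersection property and its quotient `G^s`
is a string C-group. -/
theorem isStringCGroupMod_of_intersectionPropertyOn (hM : M.IsString) {s d : ℕ} (h : s ∣ d)
    (hG : β.IsStringCGroupMod s)
    (hd : IntersectionPropertyOn (modReduction d ∘ β.gen) univ) : β.IsStringCGroupMod d where
  generates := by
    rw [group, MonoidHom.map_closure, ← range_comp]
    rfl
  involution i := by
    refine ⟨fun h1 => (hG.involution i).1 ?_, by rw [← map_pow, gen_sq, map_one]⟩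
    rw [← modCast_comp_modReduction h, MonoidHom.comp_apply, h1, map_one]
  string i j hij := by
    have hc : Commute _ _ := β.stringCommute_gen hM (modReduction d) i j hij
    simp only [Function.comp_apply] at hc
    rw [hc.mul_pow, ← map_pow, ← map_pow, gen_sq, gen_sq, map_one, mul_one]
  intersection I J := by
    refine le_antisymm (hd I J (subset_univ _) (subset_univ _)) (le_inf ?_ ?_)
    · exact standardSubgroup_mono _ inter_subset_left
    · exact standardSubgroup_mono _ inter_subset_right

theorem IsStringCGroupMod.intersectionPropertyOn {s d : ℕ} (h : s ∣ d)
    (hG : β.IsStringCGroupMod s) (S : Set (Fin n)) :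
    IntersectionPropertyOn (modCast h ∘ (modReduction d ∘ β.gen)) S := by
  rw [← Function.comp_assoc, ← MonoidHom.coe_comp, modCast_comp_modReduction]
  exact fun I J _ _ => (hG.intersection I J).le

/-- The images modulo `d` of the standard subgroups omitting `k` and `l` meet in the image of the
standard subgroup omitting both. -/
theorem EuclideanCondition.inf_le {s d : ℕ} {k l : Fin n} (h : β.EuclideanCondition s d k l) :
    standardSubgroup (modReduction d ∘ β.gen) {l}ᶜ ⊓
      standardSubgroup (modReduction d ∘ β.gen) {k}ᶜ ≤
      standardSubgroup (modReduction d ∘ β.gen) {l, k}ᶜ := by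
  simp only [← map_standardSubgroup, ← standardOmit_eq]
  rintro _ ⟨hl, g, hg, rfl⟩
  have hnorm : β.standardOmit {l, k} ≤
      Subgroup.normalizer (β.translations {k} : Set (GL (Fin n) ℤ)) :=
    h.semidirect.right_le.trans
      ((Subgroup.normal_subgroupOf_iff_le_normalizer h.semidirect.left_le).1 h.semidirect.normal)
  obtain ⟨t, ht, p, hp, rfl⟩ := exists_eq_mul_of_mem_sup h.semidirect.sup.symm hnorm hg
  have hpl : p ∈ β.standardOmit {l} :=
    standardSubgroup_mono β.gen (compl_subset_compl.2 (by simp)) hp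
  rw [map_mul] at hl ⊢
  have ht₁ : modReduction d t = 1 := by
    have : modReduction d t ∈
        (β.translations {k}).map (modReduction d) ⊓ (β.standardOmit {l}).map (modReduction d) :=
      -- The factor `p` avoids `l` as well, so it cancels and leaves `t` in the image of `G_l`.
      ⟨Subgroup.mem_map_of_mem _ ht,
        (Subgroup.mul_mem_cancel_right _ (Subgroup.mem_map_of_mem _ hpl)).1 hl⟩
    rwa [h.inter, Subgroup.mem_bot] at this
  rw [ht₁, one_mul]
  exact Subgroup.mem_map_of_mem _ hp

end CoxeterMatrix.BasicSystem

open CoxeterMatrix.BasicSystem in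
theorem theorem1 {n : ℕ} (M : CoxeterMatrix (Fin (n + 1))) (hM : M.IsString)
    (β : M.BasicSystem) (s d : ℕ) (hs : 2 ≤ s) (hd : 2 ≤ d) (hsd : s ∣ d)
    (hG : β.IsStringCGroupMod s) :
    (β.SphericalCondition s (Fin.last n) ∨ β.EuclideanCondition s d (Fin.last n) 0 →
      β.IsStringCGroupMod d) ∧
    (β.SphericalCondition s 0 ∨ β.EuclideanCondition s d 0 (Fin.last n) →
      β.IsStringCGroupMod d) := by
  have hρ := β.stringCommute_gen hM (modReduction d)
  have hφ := IsStringCGroupMod.intersectionPropertyOn β hsd hG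
  have hends : ∀ k l : Fin (n + 1), ({k} : Set (Fin (n + 1)))ᶜ ∩ {l}ᶜ = {k, l}ᶜ := fun k l => by
    rw [← Set.compl_union, Set.singleton_union]
  have glue : Set.InjOn (modReduction s)
        (standardSubgroup β.gen {0, Fin.last n}ᶜ : Set (GL (Fin (n + 1)) ℤ)) →
      standardSubgroup (modReduction d ∘ β.gen) {0}ᶜ ⊓
        standardSubgroup (modReduction d ∘ β.gen) {Fin.last n}ᶜ ≤
        standardSubgroup (modReduction d ∘ β.gen) {0, Fin.last n}ᶜ →
      IntersectionPropertyOn (modReduction d ∘ β.gen) Set.univ := fun hinj hinf => by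
    have hinj' := injOn_modCast β hsd hinj
    refine hρ.intersectionPropertyOn_univ ?_ ?_ hinf
    -- Inside each end subgroup, dropping the opposite end generator leaves the point group.
    · exact hρ.intersectionPropertyOn_of_injOn _ (hφ _) (by rwa [hends])
    · exact hρ.intersectionPropertyOn_of_injOn_zero _ (hφ _)
        (by rwa [hends, Set.pair_comm])
  constructor <;> intro h <;>
    refine β.isStringCGroupMod_of_intersectionPropertyOn hM hsd hG ?_ <;>
    obtain h | h := h
  · refine hρ.intersectionPropertyOn_of_injOn _ (hφ _) ?_
    rw [Set.univ_inter]
    exact injOn_modCast β hsd h.faithful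
  · exact glue h.faithful (EuclideanCondition.inf_le β h)
  · refine hρ.intersectionPropertyOn_of_injOn_zero _ (hφ _) ?_
    rw [Set.univ_inter]
    exact injOn_modCast β hsd h.faithful
  · refine glue (by rw [Set.pair_comm]; exact h.faithful) ?_
    rw [inf_comm, Set.pair_comm]
    exact EuclideanCondition.inf_le β h
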